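/- **Theorem 4.10.** Let $\Sigma$ be a polyhedral fan in $\mathbb R^d$, that is, a finite collection of strongly convex, finitely generated closed cones which contains every face of each of its cones and in which any two cones intersect in a common face. Let $\mathcal F(\Sigma)$ be its face poset: the set of cones of $\Sigma$ together with $\hat 0=\{0\}$, ordered by inclusion. Let $\mathcal G\subseteq\mathcal F(\Sigma)\setminus\{\hat 0\}$ be a combinatorial building set. This means that for every $x\in\mathcal F(\Sigma)\setminus\{\hat 0\}$ with $\max\mathcal G_{\le x}=\{x_1,\dots,x_k\}$ there is an isomorphism of posets $\varphi_x:\prod_{j=1}^k[\hat 0,x_j]\to[\hat 0,x]$ with $\varphi_x(\hat 0,\dots,x_j,\dots,\hat 0)=x_j$ for all $j$. A subset $N\subseteq\mathcal G$ is *nested* if every set of at least two pairwise incomparable elements of $N$ has a join in $\mathcal F(\Sigma)$ and this join does not lie in $\mathcal G$. The nested sets form an abstract simplicial complex $\mathcal N(\mathcal G)$, whose face poset consists of all nested sets, including $\emptyset$, ordered by inclusion. For a fan $\Sigma'$, a cone $\tau\in\Sigma'$ and a point $x\in\operatorname{relint}\tau$, put $\operatorname{star}(\tau,\Sigma')=\{\sigma\in\Sigma'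 : \tau\subseteq\sigma\}$. The *stellar subdivision* of $\Sigma'$ in $\tau$ (at $x$) is $$(\Sigma'\setminus\operatorname{star}(\tau,\Sigma'))\cup\{\operatorname{cone}(x,\rho) : \rho\in\Sigma'\setminus\operatorname{star}(\tau,\Sigma'),\ \rho\subseteq\sigma\text{ for some }\sigma\in\operatorname{star}(\tau,\Sigma')\}.$$ Let $G_1,\dots,G_t$ be an enumeration without repetition of $\mathcal G$ in non-increasing order (that is, $G_i\supsetneq G_j$ implies $i<j$), and let $x_i\in\operatorname{relint}G_i$ be arbitrary. Put $\Sigma_0=\Sigma$, and let $\Sigma_i$ be the stellar subdivision of $\Sigma_{i-1}$ in $G_i$ at $x_i$, for $i=1,\dots,t$. Then: 1. For every $i=1,\dots,t$, the collection $\Sigma_{i-1}$ is a fan and $G_i\in\Sigma_{i-1}$, so that each step is indeed a stellar subdivision of a fan in one of its cones. 2. $\Sigma_t$ is a simplicial subdivision of $\Sigma$: it is a fan with the same support as $\Sigma$, each of its cones is contained in a cone of $\Sigma$, and each of its cones is generated by a finite linearly independent set. 3. The face poset $\mathcal F(\Sigma_t)$ is equal to the face poset of $\mathcal N(\mathcal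 G)$, under the identification of a nested set $N$ with the cone spanned by $\{x_i : G_i\in N\}$; that is, $N\mapsto\operatorname{cone}(x_i : G_i\in N)$ is an isomorphism of posets from the face poset of $\mathcal N(\mathcal G)$ onto $\mathcal F(\Sigma_t)$. -/

import Mathlib

namespace ToricNested

section Posets

variable {L : Type*} [PartialOrder L] [OrderBot L]

/-- The set of factors of `x` in `G`, i.e. the maximal elements of `G` below `x`. -/
def factors (G : Set L) (x : L) : Set L :=
  {y | Maximal (fun z => z ∈ G ∧ z ≤ x) y}

open Classical in
/-- `G` is a (combinatorial) building set of a poset with least element `⊥`: it does not contain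
`⊥`, and for each `x ≠ ⊥` with `max G_{≤ x} = {x₁, …, x_k}` there is an isomorphism of posets
`∏ [⊥, x_j] ≅ [⊥, x]` that sends `(⊥, …, x_j, …, ⊥)` to `x_j` for every `j`.
Here `Set.Iic y` is the interval `[⊥, y]`, whose top element is `y`. -/
def IsBuildingSet (G : Set L) : Prop :=
  ⊥ ∉ G ∧ ∀ x : L, x ≠ ⊥ →
    ∃ φ : ((y : factors G x) → Set.Iic (y : L)) ≃o Set.Iic x,
      ∀ y : factors G x, (φ (Function.update ⊥ y ⊤) : L) = y

/-- `N ⊆ G` is nested if every set of at least two pairwise incomparable elements of `N` has a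
join, and this join does not lie in `G`. -/
def IsNested (G N : Set L) : Prop :=
  N ⊆ G ∧ ∀ A ⊆ N, A.Nontrivial → IsAntichain (· ≤ ·) A → ∃ j, IsLUB A j ∧ j ∉ G

/-- The face poset of the nested set complex of `G`: all nested sets, the empty face included,
ordered by inclusion. -/
abbrev NestedSetFaces (G : Set L) : Type _ := {N : Set L // IsNested G N}

end Posets

/-- The nested sets form an abstract simplicial complex: they are closed under subsets. -/
theorem IsNested.subset {P : Type*} [PartialOrder P] {G N M : Set P} (hN : IsNested G N) (h : M ⊆ N) : IsNested G M :=
  ⟨h.trans hN.1, fun A hA => hN.2 A (hA.trans h)⟩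

section Fans

variable {E : Type*} [AddCommGroup E] [Module ℝ E]

/-- A polyhedral fan: a finite collection of strongly convex polyhedral (that is, finitely
generated) cones, containing every face of each of its cones, in which any two cones intersect in
a common face. -/
structure IsFan (S : Set (PointedCone ℝ E)) : Prop where
  finite : S.Finite
  polyhedral : ∀ C ∈ S, C.FG
  salient : ∀ C ∈ S, C.toConvexCone.Salient
  face_mem : ∀ C ∈ S, ∀ F : PointedCone ℝ E, F.IsFaceOf C → F ∈ S
  inter_face : ∀ C ∈ S, ∀ D ∈ S, (C ⊓ D).IsFaceOf C ∧ (C ⊓ D).IsFaceOf D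

/-- The face poset of a fan: its cones, together with the zero cone as a least element, ordered
by inclusion. -/
abbrev FacePoset (S : Set (PointedCone ℝ E)) : Type _ :=
  {C : PointedCone ℝ E // C ∈ insert (⊥ : PointedCone ℝ E) S}

instance instOrderBotFacePoset (S : Set (PointedCone ℝ E)) : OrderBot (FacePoset S) where
  bot := ⟨⊥, Set.mem_insert _ _⟩
  bot_le C := (bot_le : (⊥ : PointedCone ℝ E) ≤ C.1)

/-- The support of a collection of cones. -/
def support (S : Set (PointedCone ℝ E)) : Set E := {v | ∃ C ∈ S, v ∈ C}

/-- `S'` is a subdivision of `S`: it is a fan with the same support as `S`, and each of its cones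
is contained in a cone of `S`. -/
structure IsSubdivision (S' S : Set (PointedCone ℝ E)) : Prop where
  isFan : IsFan S'
  refines : ∀ C' ∈ S', ∃ C ∈ S, C' ≤ C
  support_eq : support S' = support S

/-- The star of `τ` in `S`: the cones of `S` that contain `τ`. -/
def coneStar (τ : PointedCone ℝ E) (S : Set (PointedCone ℝ E)) : Set (PointedCone ℝ E) :=
  {σ ∈ S | τ ≤ σ}

/-- The stellar subdivision of `S` in a point `x` of the relative interior of the cone `τ` of `S`.
The star of `τ` is removed, and for each remaining cone `ρ` that lies in some cone of the star,
the cone spanned by `x` and `ρ` is added. -/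
def stellarSubdivision (S : Set (PointedCone ℝ E)) (τ : PointedCone ℝ E) (x : E) :
    Set (PointedCone ℝ E) :=
  (S \ coneStar τ S) ∪
    {C | ∃ ρ ∈ S \ coneStar τ S, (∃ σ ∈ coneStar τ S, ρ ≤ σ) ∧ C = PointedCone.hull ℝ {x} ⊔ ρ}

end Fans

end ToricNested

namespace ToricNested

open PointedCone Set

/-! ### Faces of cones and stellar subdivisions of fans. -/

section Algebraic

variable {E : Type*} [AddCommGroup E] [Module ℝ E]

/-! The proof is an induction with a description of every intermediate fan. Let `P` be the set of
elements already subdivided. The cones are then indexed by `blowupFaces 𝒢 P`: pairs `(N, ρ)` with `N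
⊆ P`, with `ρ` above no element of `P`, and with `N ∪ factors 𝒢 ρ` nested. The cone of such a pair
is spanned by the chosen points of `N` together with `ρ`. For `P = ∅` this is the original fan. For
`P = 𝒢` it forces `ρ = 0`, because every element is the join of its factors, and what remains is the
nested set complex. The predicate `IsBlowup` records this, along with order reflection and linear
independence.

In the step for `g`, everything in `𝒢` strictly above `g` lies in `P` and nothing in `P` lies below
`g`. The star of `g` therefore consists of the pairs with `g ≤ ρ`. That the cones over the link are
exactly the new pairs is pure combinatorics, in `insert_mem_blowupFaces` and
`exists_mem_blowupFaces_of_insert`. Both rest on `IsNested.exists_le_of_le_isLUB`, a consequence of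
the product decomposition of intervals.

The geometric input is that stellar subdivision preserves fans (`IsFan.stellarSubdivision`) and
supports (`exists_face_mem_hull_sup`), and that the new point lies outside the linear span of each
base it is coned with (`notMem_span_of_face`), so independence persists. -/

theorem mem_hull_singleton_sup {x y : E} {ρ : PointedCone ℝ E} :
    y ∈ PointedCone.hull ℝ {x} ⊔ ρ ↔ ∃ s : ℝ, 0 ≤ s ∧ ∃ r ∈ ρ, s • x + r = y := by
  rw [Submodule.mem_sup]
  constructor
  · rintro ⟨a, ha, r, hr, rfl⟩
    obtain ⟨s, rfl⟩ := Submodule.mem_span_singleton.1 ha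
    exact ⟨s, s.2, r, hr, rfl⟩
  · rintro ⟨s, hs, r, hr, rfl⟩
    exact ⟨s • x, Submodule.mem_span_singleton.2 ⟨⟨s, hs⟩, rfl⟩, r, hr, rfl⟩

theorem self_mem_hull_singleton_sup (x : E) (ρ : PointedCone ℝ E) :
    x ∈ PointedCone.hull ℝ {x} ⊔ ρ :=
  mem_hull_singleton_sup.2 ⟨1, zero_le_one, 0, ρ.zero_mem, by simp⟩

theorem hull_singleton_sup_le {x : E} {ρ σ : PointedCone ℝ E} (hx : x ∈ σ) (h : ρ ≤ σ) :
    PointedCone.hull ℝ {x} ⊔ ρ ≤ σ :=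
  sup_le (Submodule.span_le.2 (by simpa using hx)) h

/-- If `s • x + r` lies in a face not containing `x`, then `s = 0`. -/
theorem eq_zero_of_smul_add_mem_face {σ F : PointedCone ℝ E} (hF : F.IsFaceOf σ) {x r : E}
    (hxσ : x ∈ σ) (hxF : x ∉ F) (hr : r ∈ σ) {s : ℝ} (hs : 0 ≤ s) (h : s • x + r ∈ F) : s = 0 := by
  by_contra hne
  exact hxF (hF.mem_of_smul_add_mem hxσ hr (lt_of_le_of_ne hs (Ne.symm hne)) h)

/-- Cancelling the smaller multiple of `x` leaves a multiple of `x` plus a point of `σ` inside a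
face that misses `x`, so the leftover coefficient vanishes. -/
theorem smul_add_unique_of_faces {σ F₁ F₂ : PointedCone ℝ E} (h₁ : F₁.IsFaceOf σ)
    (h₂ : F₂.IsFaceOf σ) {x r₁ r₂ : E} (hxσ : x ∈ σ) (hx₁ : x ∉ F₁) (hx₂ : x ∉ F₂)
    (hr₁ : r₁ ∈ F₁) (hr₂ : r₂ ∈ F₂) {s₁ s₂ : ℝ} (h : s₁ • x + r₁ = s₂ • x + r₂) :
    s₁ = s₂ ∧ r₁ = r₂ := by
  have hs : s₁ = s₂ := by
    rcases le_total s₁ s₂ with hle | hle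
    · have : (s₂ - s₁) • x + r₂ ∈ F₁ := by
        convert hr₁ using 1
        rw [sub_smul, sub_add_eq_add_sub, ← h]; abel
      linarith [eq_zero_of_smul_add_mem_face h₁ hxσ hx₁ (h₂.le hr₂) (sub_nonneg.2 hle) this]
    · have : (s₁ - s₂) • x + r₁ ∈ F₂ := by
        convert hr₂ using 1
        rw [sub_smul, sub_add_eq_add_sub, h]; abel
      linarith [eq_zero_of_smul_add_mem_face h₂ hxσ hx₂ (h₁.le hr₁) (sub_nonneg.2 hle) this]
  subst hs
  exact ⟨rfl, add_left_cancel h⟩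

theorem notMem_span_of_face {σ F : PointedCone ℝ E} (hF : F.IsFaceOf σ) {x : E}
    (hxσ : x ∈ σ) (hxF : x ∉ F) : x ∉ Submodule.span ℝ (F : Set E) := by
  -- The linear span of a cone consists of differences of its points, and `x = a - b` means `x + b =
  -- a ∈ F`.
  suffices h : ∀ v ∈ Submodule.span ℝ (F : Set E), ∃ a ∈ F, ∃ b ∈ F, v = a - b by
    intro hx
    obtain ⟨a, ha, b, hb, rfl⟩ := h x hx
    exact hxF (hF.mem_of_add_mem_left hxσ (hF.le hb) (by simpa using ha))
  intro v hv
  induction hv using Submodule.span_induction with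
  | mem v hv => exact ⟨v, hv, 0, F.zero_mem, by simp⟩
  | zero => exact ⟨0, F.zero_mem, 0, F.zero_mem, by simp⟩
  | add v w _ _ hv hw =>
    obtain ⟨a, ha, b, hb, rfl⟩ := hv
    obtain ⟨c, hc, d, hd, rfl⟩ := hw
    exact ⟨a + c, F.add_mem ha hc, b + d, F.add_mem hb hd, by abel⟩
  | smul k v _ hv =>
    obtain ⟨a, ha, b, hb, rfl⟩ := hv
    rcases le_total 0 k with hk | hk
    · exact ⟨k • a, PointedCone.smul_mem F hk ha, k • b, PointedCone.smul_mem F hk hb,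
        smul_sub _ _ _⟩
    · refine ⟨(-k) • b, PointedCone.smul_mem F (neg_nonneg.2 hk) hb, (-k) • a,
        PointedCone.smul_mem F (neg_nonneg.2 hk) ha, ?_⟩
      simp only [neg_smul, smul_sub]; abel

theorem bot_isFaceOf_of_salient {σ : PointedCone ℝ E} (hσ : σ.toConvexCone.Salient) :
    (⊥ : PointedCone ℝ E).IsFaceOf σ := by
  refine ⟨bot_le, ?_⟩
  intro u v a hu hv ha h
  rw [Submodule.mem_bot] at h ⊢
  by_contra hne
  refine hσ (a • u) (PointedCone.smul_mem σ ha.le hu) (smul_ne_zero ha.ne' hne) ?_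
  rwa [neg_eq_of_add_eq_zero_right h]

namespace IsFan

variable {T : Set (PointedCone ℝ E)}

theorem isFaceOf (hT : IsFan T) {ρ σ : PointedCone ℝ E} (hρ : ρ ∈ T) (hσ : σ ∈ T) (h : ρ ≤ σ) :
    ρ.IsFaceOf σ := by
  simpa [inf_eq_left.2 h] using (hT.inter_face ρ hρ σ hσ).2

theorem inf_mem (hT : IsFan T) {ρ σ : PointedCone ℝ E} (hρ : ρ ∈ T) (hσ : σ ∈ T) : ρ ⊓ σ ∈ T :=
  hT.face_mem ρ hρ _ (hT.inter_face ρ hρ σ hσ).1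

theorem bot_mem (hT : IsFan T) {σ : PointedCone ℝ E} (hσ : σ ∈ T) : ⊥ ∈ T :=
  hT.face_mem σ hσ _ (bot_isFaceOf_of_salient (hT.salient σ hσ))

/-- The face property is inherited from `σ`, which contains the whole cone over `ρ`. The conditions
on `x` make `τ` the smallest cone of the fan through `x`; this is all the algebraic part needs of
the relative interior. -/
theorem hull_sup_isFaceOf (hT : IsFan T) {τ : PointedCone ℝ E} {x : E} (hx : x ∈ τ)
    (hxT : ∀ ρ ∈ T, x ∈ ρ → τ ≤ ρ) {ρ σ : PointedCone ℝ E} (hρ : ρ ∈ T) (hρτ : ¬ τ ≤ ρ)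
    (hσ : σ ∈ T) (hτσ : τ ≤ σ) (hρσ : ρ ≤ σ) : ρ.IsFaceOf (PointedCone.hull ℝ {x} ⊔ ρ) := by
  have hf := hT.isFaceOf hρ hσ hρσ
  have hxρ : x ∉ ρ := fun h => hρτ (hxT ρ hρ h)
  have hle := hull_singleton_sup_le (hτσ hx) hρσ
  exact ⟨le_sup_right, fun hu hv ha h => hf.mem_of_smul_add_mem (hle hu) (hle hv) ha h⟩

/-- The intersection of a new cone with an old one. -/
theorem hull_sup_inf (hT : IsFan T) {τ : PointedCone ℝ E} {x : E} (hx : x ∈ τ)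
    (hxT : ∀ ρ ∈ T, x ∈ ρ → τ ≤ ρ) {ρ σ C : PointedCone ℝ E}
    (hσ : σ ∈ T) (hτσ : τ ≤ σ) (hρσ : ρ ≤ σ) (hC : C ∈ T) (hCτ : ¬ τ ≤ C) :
    (PointedCone.hull ℝ {x} ⊔ ρ) ⊓ C = ρ ⊓ C := by
  refine le_antisymm ?_ (inf_le_inf_right _ le_sup_right)
  rintro y ⟨hy, hyC⟩
  obtain ⟨s, hs, r, hr, rfl⟩ := mem_hull_singleton_sup.1 hy
  have hσC := (hT.inter_face σ hσ C hC).1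
  have h0 := eq_zero_of_smul_add_mem_face hσC (hτσ hx) (fun h => hCτ (hxT C hC h.2)) (hρσ hr) hs
    ⟨hull_singleton_sup_le (hτσ hx) hρσ hy, hyC⟩
  subst h0
  exact ⟨by simpa using hr, hyC⟩

/-- The intersection of two new cones. -/
theorem hull_sup_inf_hull_sup (hT : IsFan T) {τ : PointedCone ℝ E} {x : E} (hx : x ∈ τ)
    (hxT : ∀ ρ ∈ T, x ∈ ρ → τ ≤ ρ) {ρ₁ σ₁ ρ₂ σ₂ : PointedCone ℝ E}
    (hρ₁ : ρ₁ ∈ T) (hρτ₁ : ¬ τ ≤ ρ₁) (hσ₁ : σ₁ ∈ T) (hτσ₁ : τ ≤ σ₁) (hρσ₁ : ρ₁ ≤ σ₁)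
    (hρ₂ : ρ₂ ∈ T) (hρτ₂ : ¬ τ ≤ ρ₂) (hσ₂ : σ₂ ∈ T) (hτσ₂ : τ ≤ σ₂) (hρσ₂ : ρ₂ ≤ σ₂) :
    (PointedCone.hull ℝ {x} ⊔ ρ₁) ⊓ (PointedCone.hull ℝ {x} ⊔ ρ₂) =
      PointedCone.hull ℝ {x} ⊔ (ρ₁ ⊓ ρ₂) := by
  refine le_antisymm ?_ (le_inf (sup_le_sup_left inf_le_left _) (sup_le_sup_left inf_le_right _))
  rintro y ⟨hy₁, hy₂⟩
  obtain ⟨s₁, hs₁, r₁, hr₁, rfl⟩ := mem_hull_singleton_sup.1 hy₁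
  obtain ⟨s₂, hs₂, r₂, hr₂, h⟩ := mem_hull_singleton_sup.1 hy₂
  -- If the coefficients differed, the difference would put a point with a positive `x`-coefficient
  -- into one base. By `hull_sup_inf` that point also lies in the other base, a face missing `x`.
  suffices hs : s₁ = s₂ by
    subst hs
    obtain rfl := add_left_cancel h
    exact mem_hull_singleton_sup.2 ⟨_, hs₂, r₂, ⟨hr₁, hr₂⟩, rfl⟩
  rcases le_total s₁ s₂ with hle | hle
  · have hmem : (s₂ - s₁) • x + r₂ = r₁ := by
      rw [sub_smul, sub_add_eq_add_sub, h]; abel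
    have hin : (s₂ - s₁) • x + r₂ ∈ (PointedCone.hull ℝ {x} ⊔ ρ₂) ⊓ ρ₁ :=
      ⟨mem_hull_singleton_sup.2 ⟨_, sub_nonneg.2 hle, r₂, hr₂, rfl⟩, by rwa [hmem]⟩
    rw [hT.hull_sup_inf hx hxT hσ₂ hτσ₂ hρσ₂ hρ₁ hρτ₁] at hin
    linarith [eq_zero_of_smul_add_mem_face (hT.isFaceOf hρ₂ hσ₂ hρσ₂) (hτσ₂ hx)
      (fun h => hρτ₂ (hxT _ hρ₂ h)) (hρσ₂ hr₂) (sub_nonneg.2 hle) hin.1]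
  · have hmem : (s₁ - s₂) • x + r₁ = r₂ := by
      rw [sub_smul, sub_add_eq_add_sub, ← h]; abel
    have hin : (s₁ - s₂) • x + r₁ ∈ (PointedCone.hull ℝ {x} ⊔ ρ₁) ⊓ ρ₂ :=
      ⟨mem_hull_singleton_sup.2 ⟨_, sub_nonneg.2 hle, r₁, hr₁, rfl⟩, by rwa [hmem]⟩
    rw [hT.hull_sup_inf hx hxT hσ₁ hτσ₁ hρσ₁ hρ₂ hρτ₂] at hin
    linarith [eq_zero_of_smul_add_mem_face (hT.isFaceOf hρ₁ hσ₁ hρσ₁) (hτσ₁ hx)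
      (fun h => hρτ₁ (hxT _ hρ₁ h)) (hρσ₁ hr₁) (sub_nonneg.2 hle) hin.1]

/-- A face of `ρ` spans together with `x` a face of the cone over `ρ`. -/
theorem hull_sup_isFaceOf_hull_sup {σ ρ F : PointedCone ℝ E} {x : E} (hρσ : ρ.IsFaceOf σ)
    (hxσ : x ∈ σ) (hxρ : x ∉ ρ) (hF : F.IsFaceOf ρ) :
    (PointedCone.hull ℝ {x} ⊔ F).IsFaceOf (PointedCone.hull ℝ {x} ⊔ ρ) := by
  refine IsFaceOf.of_mem_of_add_mem_left (sup_le_sup_left hF.le _) ?_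
  intro u v hu hv h
  obtain ⟨s₁, hs₁, r₁, hr₁, rfl⟩ := mem_hull_singleton_sup.1 hu
  obtain ⟨s₂, hs₂, r₂, hr₂, rfl⟩ := mem_hull_singleton_sup.1 hv
  obtain ⟨s, hs, r, hr, hsum⟩ := mem_hull_singleton_sup.1 h
  have heq : s • x + r = (s₁ + s₂) • x + (r₁ + r₂) := by rw [hsum, add_smul]; abel
  obtain ⟨-, rfl⟩ := smul_add_unique_of_faces hρσ hρσ hxσ hxρ hxρ (hF.le hr)
    (ρ.add_mem hr₁ hr₂) heq
  exact mem_hull_singleton_sup.2 ⟨s₁, hs₁, r₁, hF.mem_of_add_mem_left hr₁ hr₂ hr, rfl⟩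

/-- A stellar subdivision of a fan is a fan. -/
theorem stellarSubdivision (hT : IsFan T) {τ : PointedCone ℝ E} {x : E} (hx : x ∈ τ)
    (hxT : ∀ ρ ∈ T, x ∈ ρ → τ ≤ ρ) : IsFan (stellarSubdivision T τ x) := by
  constructor
  · refine (hT.finite.subset sdiff_subset).union
      ((hT.finite.image fun ρ => PointedCone.hull ℝ {x} ⊔ ρ).subset ?_)
    rintro _ ⟨ρ, hρ, -, rfl⟩
    exact ⟨ρ, hρ.1, rfl⟩
  · rintro C (hC | ⟨ρ, hρ, -, rfl⟩)
    · exact hT.polyhedral C hC.1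
    · exact (Submodule.fg_span_singleton x).sup (hT.polyhedral ρ hρ.1)
  · rintro C (hC | ⟨ρ, hρ, ⟨σ, hσ, hρσ⟩, rfl⟩)
    · exact hT.salient C hC.1
    · have hle := hull_singleton_sup_le (hσ.2 hx) hρσ
      exact fun u hu hu0 hun => hT.salient σ hσ.1 u (hle hu) hu0 (hle hun)
  · rintro C (hC | ⟨ρ, hρ, ⟨σ, hσ, hρσ⟩, rfl⟩) F hF
    · exact Or.inl ⟨hT.face_mem C hC.1 F hF, fun h => hC.2 ⟨hC.1, h.2.trans hF.le⟩⟩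
    · have hρτ : ¬ τ ≤ ρ := fun h => hρ.2 ⟨hρ.1, h⟩
      have hρH := hT.hull_sup_isFaceOf hx hxT hρ.1 hρτ hσ.1 hσ.2 hρσ
      have hFρ : (F ⊓ ρ).IsFaceOf ρ := by
        have := hF.inf (IsFaceOf.refl ρ)
        rwa [inf_eq_right.2 hρH.le] at this
      have hmem := hT.face_mem ρ hρ.1 _ hFρ
      have hnot : ¬ τ ≤ F ⊓ ρ := fun h => hρτ (h.trans inf_le_right)
      -- A face through `x` is the cone over its trace on `ρ`; a face missing `x` lies inside `ρ`.
      by_cases hxF : x ∈ F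
      · refine Or.inr ⟨F ⊓ ρ, ⟨hmem, fun h => hnot h.2⟩, ⟨σ, hσ, inf_le_right.trans hρσ⟩, ?_⟩
        refine le_antisymm ?_ (hull_singleton_sup_le hxF inf_le_left)
        intro y hy
        obtain ⟨s, hs, r, hr, rfl⟩ := mem_hull_singleton_sup.1 (hF.le hy)
        exact mem_hull_singleton_sup.2 ⟨s, hs, r, ⟨hF.mem_of_add_mem_right
          (PointedCone.smul_mem _ hs (self_mem_hull_singleton_sup x ρ)) (hρH.le hr) hy, hr⟩, rfl⟩
      · have hle : F ≤ ρ := by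
          intro y hy
          obtain ⟨s, hs, r, hr, rfl⟩ := mem_hull_singleton_sup.1 (hF.le hy)
          rw [eq_zero_of_smul_add_mem_face hF (self_mem_hull_singleton_sup x ρ) hxF
            (hρH.le hr) hs hy]
          simpa using hr
        rw [inf_eq_left.2 hle] at hmem hnot
        exact Or.inl ⟨hmem, fun h => hnot h.2⟩
  · have key : ∀ ρ ∈ T \ coneStar τ T, (∃ σ ∈ coneStar τ T, ρ ≤ σ) → ∀ D ∈ T \ coneStar τ T,
        ((PointedCone.hull ℝ {x} ⊔ ρ) ⊓ D).IsFaceOf (PointedCone.hull ℝ {x} ⊔ ρ) ∧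
          ((PointedCone.hull ℝ {x} ⊔ ρ) ⊓ D).IsFaceOf D := by
      rintro ρ hρ ⟨σ, hσ, hρσ⟩ D hD
      have hρτ : ¬ τ ≤ ρ := fun h => hρ.2 ⟨hρ.1, h⟩
      rw [hT.hull_sup_inf hx hxT hσ.1 hσ.2 hρσ hD.1 fun h => hD.2 ⟨hD.1, h⟩]
      have hface := hT.inter_face ρ hρ.1 D hD.1
      exact ⟨hface.1.trans (hT.hull_sup_isFaceOf hx hxT hρ.1 hρτ hσ.1 hσ.2 hρσ), hface.2⟩
    rintro C (hC | ⟨ρ, hρ, hρst, rfl⟩) D (hD | ⟨μ, hμ, hμst, rfl⟩)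
    · exact hT.inter_face C hC.1 D hD.1
    · rw [inf_comm]
      exact (key μ hμ hμst C hC).symm
    · exact key ρ hρ hρst D hD
    · obtain ⟨σ, hσ, hρσ⟩ := hρst
      obtain ⟨σ', hσ', hμσ'⟩ := hμst
      have hρτ : ¬ τ ≤ ρ := fun h => hρ.2 ⟨hρ.1, h⟩
      have hμτ : ¬ τ ≤ μ := fun h => hμ.2 ⟨hμ.1, h⟩
      rw [hT.hull_sup_inf_hull_sup hx hxT hρ.1 hρτ hσ.1 hσ.2 hρσ hμ.1 hμτ hσ'.1 hσ'.2 hμσ']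
      have hface := hT.inter_face ρ hρ.1 μ hμ.1
      exact ⟨hull_sup_isFaceOf_hull_sup (hT.isFaceOf hρ.1 hσ.1 hρσ) (hσ.2 hx)
          (fun h => hρτ (hxT ρ hρ.1 h)) hface.1,
        hull_sup_isFaceOf_hull_sup (hT.isFaceOf hμ.1 hσ'.1 hμσ') (hσ'.2 hx)
          (fun h => hμτ (hxT μ hμ.1 h)) hface.2⟩

end IsFan

/-- The smallest face of `σ` that contains the point `z` of `σ`. -/
def minimalFace (σ : PointedCone ℝ E) (z : E) (hz : z ∈ σ) : PointedCone ℝ E where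
  carrier := {w | w ∈ σ ∧ ∃ k : ℝ, 0 ≤ k ∧ k • z - w ∈ σ}
  zero_mem' := ⟨σ.zero_mem, 1, zero_le_one, by simpa using hz⟩
  add_mem' := by
    rintro v w ⟨hv, k, hk, hkv⟩ ⟨hw, l, hl, hlw⟩
    refine ⟨σ.add_mem hv hw, k + l, add_nonneg hk hl, ?_⟩
    convert σ.add_mem hkv hlw using 1
    rw [add_smul]; abel
  smul_mem' := by
    rintro ⟨c, hc⟩ w ⟨hw, k, hk, hkw⟩
    refine ⟨PointedCone.smul_mem σ hc hw, c * k, mul_nonneg hc hk, ?_⟩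
    convert PointedCone.smul_mem σ hc hkw using 1
    rw [smul_sub, mul_smul]; rfl

theorem minimalFace_isFaceOf {σ : PointedCone ℝ E} {z : E} (hz : z ∈ σ) :
    (minimalFace σ z hz).IsFaceOf σ := by
  refine IsFaceOf.of_mem_of_add_mem_left (fun w hw => hw.1) ?_
  rintro u v hu hv ⟨-, k, hk, hkuv⟩
  refine ⟨hu, k, hk, ?_⟩
  convert σ.add_mem hkuv hv using 1
  abel

theorem self_mem_minimalFace {σ : PointedCone ℝ E} {z : E} (hz : z ∈ σ) :
    z ∈ minimalFace σ z hz :=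
  ⟨hz, 1, zero_le_one, by simp⟩

end Algebraic

/-! ### Supports and relative interiors. -/

section Normed

variable {E : Type*} [NormedAddCommGroup E] [NormedSpace ℝ E]

/-- In a strongly convex polyhedral cone one can only move a bounded distance from `y` in the
direction opposite to `x`, and the bound is attained. -/
theorem exists_max_sub_smul_mem {σ : PointedCone ℝ E} (hfg : σ.FG)
    (hs : σ.toConvexCone.Salient) {x y : E} (hx : x ∈ σ) (hx0 : x ≠ 0) (hy : y ∈ σ) :
    ∃ s : ℝ, 0 ≤ s ∧ y - s • x ∈ σ ∧ ∀ s', s < s' → y - s' • x ∉ σ := by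
  classical
  obtain ⟨A, rfl⟩ := hfg
  set σ := Submodule.span {c : ℝ // 0 ≤ c} (A : Set E) with hσ
  -- With `x` among the generators, the multiple of `x` to be maximized is a coordinate. With `0`
  -- removed, no nontrivial nonnegative combination vanishes.
  set B := (insert x A).erase 0 with hB
  have hspan : Submodule.span {c : ℝ // 0 ≤ c} (range ((↑) : B → E)) = σ := by
    rw [Subtype.range_coe_subtype]
    apply le_antisymm
    · refine Submodule.span_le.2 ?_
      intro v hv
      have hv : v ∈ B := hv
      rcases Finset.mem_insert.1 (Finset.mem_of_mem_erase hv) with rfl | h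
      · exact hx
      · exact Submodule.subset_span h
    · refine Submodule.span_le.2 ?_
      intro v hv
      by_cases h0 : v = 0
      · rw [h0]; exact Submodule.zero_mem _
      · exact Submodule.subset_span (Finset.mem_erase.2 ⟨h0, Finset.mem_insert_of_mem hv⟩)
  have hBσ : ∀ i : B, (i : E) ∈ σ := fun i => hspan ▸ Submodule.subset_span ⟨i, rfl⟩
  let f : (B → ℝ) → E := fun c => ∑ i, c i • (i : E)
  have hf : Continuous f := by fun_prop
  have hmem : ∀ w, w ∈ σ → ∃ c : B → ℝ, 0 ≤ c ∧ f c = w := by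
    intro w hw
    rw [← hspan, Submodule.mem_span_range_iff_exists_fun] at hw
    obtain ⟨c, hc⟩ := hw
    exact ⟨fun i => c i, fun i => (c i).2, hc⟩
  let x' : B := ⟨x, Finset.mem_erase.2 ⟨hx0, Finset.mem_insert_self _ _⟩⟩
  have hne : ∀ c ∈ stdSimplex ℝ B, f c ≠ 0 := by
    intro c hc h0
    obtain ⟨i, hi⟩ : ∃ i, 0 < c i := by
      by_contra! hneg
      have := Finset.sum_nonpos fun i (_ : i ∈ Finset.univ) => hneg i
      rw [hc.2] at this
      linarith
    have := (bot_isFaceOf_of_salient hs).mem_of_sum_smul_mem hBσ hc.1 (show f c ∈ (⊥ : PointedCone ℝ E) by simp [h0]) i hi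
    exact (Finset.mem_erase.1 i.2).1 (by simpa using this)
  have : Nonempty B := ⟨x'⟩
  obtain ⟨c₀, hc₀, hmin⟩ := (isCompact_stdSimplex ℝ B).exists_isMinOn
    ⟨_, single_mem_stdSimplex ℝ x'⟩ hf.norm.continuousOn
  have hm : 0 < ‖f c₀‖ := norm_pos_iff.2 (hne c₀ hc₀)
  -- The nonnegative coordinate vectors of `y`. The positive minimum of `‖f‖` on the simplex bounds
  -- their coordinate sum, so `K` is compact.
  let K : Set (B → ℝ) := {c | 0 ≤ c ∧ f c = y}
  have hKc : IsClosed K :=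
    (isClosed_le continuous_const continuous_id).inter (isClosed_eq hf continuous_const)
  have hKb : K ⊆ Icc 0 fun _ => ‖y‖ / ‖f c₀‖ := by
    rintro c ⟨hc, hcy⟩
    refine ⟨hc, fun i => ?_⟩
    have hle : c i ≤ ∑ j, c j := Finset.single_le_sum (fun j _ => hc j) (Finset.mem_univ i)
    refine hle.trans ?_
    rcases (Finset.sum_nonneg fun j (_ : j ∈ Finset.univ) => hc j).eq_or_lt with h0 | hpos
    · rw [← h0]; positivity
    · have hmem : (∑ j, c j)⁻¹ • c ∈ stdSimplex ℝ B := by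
        refine ⟨fun j => mul_nonneg (inv_nonneg.2 hpos.le) (hc j), ?_⟩
        simp only [Pi.smul_apply, smul_eq_mul, ← Finset.mul_sum]
        exact inv_mul_cancel₀ hpos.ne'
      have hfs : f ((∑ j, c j)⁻¹ • c) = (∑ j, c j)⁻¹ • y := by
        rw [← hcy]
        simp only [f, Finset.smul_sum, Pi.smul_apply, smul_eq_mul, mul_smul]
      have h := isMinOn_iff.1 hmin _ hmem
      rw [hfs, norm_smul, Real.norm_of_nonneg (inv_nonneg.2 hpos.le), inv_mul_eq_div,
        le_div_iff₀ hpos] at h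
      rw [le_div_iff₀ hm]
      linarith
  have hK : IsCompact K := isCompact_Icc.of_isClosed_subset hKc hKb
  obtain ⟨c₁, hc₁, hc₁y⟩ := hmem y hy
  obtain ⟨c, hc, hmax⟩ := hK.exists_isMaxOn ⟨c₁, hc₁, hc₁y⟩ (continuous_apply x').continuousOn
  refine ⟨c x', hc.1 x', ?_, ?_⟩
  · have : y - c x' • x = ∑ i ∈ Finset.univ.erase x', c i • (i : E) := by
      rw [sub_eq_iff_eq_add, ← hc.2]
      exact (Finset.sum_erase_add _ _ (Finset.mem_univ x')).symm
    rw [this]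
    exact Submodule.sum_mem _ fun i _ => PointedCone.smul_mem σ (hc.1 i) (hBσ i)
  · intro s' hs' hmem'
    obtain ⟨b, hb, hbf⟩ := hmem _ hmem'
    have hs0 : 0 ≤ s' := (hc.1 x').trans hs'.le
    have hK' : b + Pi.single x' s' ∈ K := by
      refine ⟨add_nonneg hb (Pi.single_nonneg.2 hs0), ?_⟩
      have : f (b + Pi.single x' s') = f b + s' • x := by
        simp only [f, Pi.add_apply, add_smul, Finset.sum_add_distrib]
        congr 1
        rw [Finset.sum_eq_single x']
        · simp [x']
        · intro j _ hj; simp [Pi.single_eq_of_ne hj]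
        · simp
      rw [this, hbf, sub_add_cancel]
    have h1 := isMaxOn_iff.1 hmax _ hK'
    have h2 := hb x'
    simp only [Pi.add_apply, Pi.single_eq_same, Pi.zero_apply] at h1 h2
    linarith

/-- Every point of a strongly convex polyhedral cone lies in the cone spanned by a given nonzero
point `x` of it and a face that does not contain `x`. -/
theorem exists_face_mem_hull_sup {σ : PointedCone ℝ E} (hfg : σ.FG)
    (hs : σ.toConvexCone.Salient) {x y : E} (hx : x ∈ σ) (hx0 : x ≠ 0) (hy : y ∈ σ) :
    ∃ ρ : PointedCone ℝ E, ρ.IsFaceOf σ ∧ x ∉ ρ ∧ y ∈ PointedCone.hull ℝ {x} ⊔ ρ := by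
  obtain ⟨s, hs0, hmem, hmax⟩ := exists_max_sub_smul_mem hfg hs hx hx0 hy
  refine ⟨minimalFace σ _ hmem, minimalFace_isFaceOf hmem, ?_,
    mem_hull_singleton_sup.2 ⟨s, hs0, _, self_mem_minimalFace hmem, by abel⟩⟩
  rintro ⟨-, k, hk, hkx⟩
  have hk1 : 0 < k + 1 := by linarith
  -- With `z = y - s • x`, scaling `z - (k + 1)⁻¹ • x` by `k + 1` gives `(k • z - x) + z`, a sum of
  -- two points of `σ`.
  refine hmax (s + (k + 1)⁻¹) (by linarith [inv_pos.2 hk1]) ?_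
  rw [← PointedCone.smul_mem_iff σ hk1]
  convert σ.add_mem hkx hmem using 1
  match_scalars <;> field_simp
  ring

/-- A point of a star cone lies in the cone over a face missing `x`; that face is outside the star,
so the cone over it belongs to the subdivision. -/
theorem IsFan.isSubdivision_stellarSubdivision {T : Set (PointedCone ℝ E)} (hT : IsFan T)
    {τ : PointedCone ℝ E} {x : E} (hx : x ∈ τ) (hx0 : x ≠ 0)
    (hxT : ∀ ρ ∈ T, x ∈ ρ → τ ≤ ρ) : IsSubdivision (ToricNested.stellarSubdivision T τ x) T := by
  have href : ∀ C' ∈ ToricNested.stellarSubdivision T τ x, ∃ C ∈ T, C' ≤ C := by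
    rintro C (hC | ⟨ρ, hρ, ⟨σ, hσ, hρσ⟩, rfl⟩)
    · exact ⟨C, hC.1, le_rfl⟩
    · exact ⟨σ, hσ.1, hull_singleton_sup_le (hσ.2 hx) hρσ⟩
  refine ⟨hT.stellarSubdivision hx hxT, href, Subset.antisymm ?_ ?_⟩
  · rintro v ⟨C', hC', hv⟩
    obtain ⟨C, hC, hle⟩ := href C' hC'
    exact ⟨C, hC, hle hv⟩
  · rintro y ⟨σ, hσ, hy⟩
    by_cases hτσ : τ ≤ σ
    · obtain ⟨ρ, hρ, hxρ, hyρ⟩ :=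
        exists_face_mem_hull_sup (hT.polyhedral σ hσ) (hT.salient σ hσ) (hτσ hx) hx0 hy
      exact ⟨_, Or.inr ⟨ρ, ⟨hT.face_mem σ hσ ρ hρ, fun h => hxρ (h.2 hx)⟩, ⟨σ, ⟨hσ, hτσ⟩, hρ.le⟩,
        rfl⟩, hyρ⟩
    · exact ⟨σ, Or.inl ⟨hσ, fun h => hτσ h.2⟩, hy⟩

/-- A face of a cone that meets its relative interior is the whole cone. -/
theorem le_of_mem_intrinsicInterior {τ F : PointedCone ℝ E} (hF : F.IsFaceOf τ) {x : E}
    (hx : x ∈ intrinsicInterior ℝ (τ : Set E)) (hxF : x ∈ F) : τ ≤ F := by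
  intro y hy
  obtain ⟨p, hp, rfl⟩ := mem_intrinsicInterior.1 hx
  let q : affineSpan ℝ (τ : Set E) := ⟨y, subset_affineSpan ℝ _ hy⟩
  -- The line from `y` through `p`, continued past `p`: the point `g s` equals `(1 + s) • p - s • y`
  -- and stays in `τ` for small `s > 0`.
  let g : ℝ → affineSpan ℝ (τ : Set E) := fun s => AffineMap.lineMap p q (-s)
  have hg : Continuous g := by
    rw [continuous_induced_rng]
    have : (Subtype.val ∘ g) = fun s : ℝ => AffineMap.lineMap (p : E) y (-s) := by
      ext s
      simp [g, q, AffineMap.lineMap_apply]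
    rw [this]
    fun_prop
  have hev : ∀ᶠ s in nhds (0 : ℝ), g s ∈ interior (((↑) : affineSpan ℝ (τ : Set E) → E) ⁻¹' (τ : Set E)) :=
    hg.continuousAt.eventually_mem (isOpen_interior.mem_nhds (by simpa [g] using hp))
  obtain ⟨s, hs, hs0⟩ := ((hev.filter_mono nhdsWithin_le_nhds).and
    (self_mem_nhdsWithin : Ioi (0 : ℝ) ∈ nhdsWithin 0 (Ioi 0))).exists
  have hmem : ((g s : affineSpan ℝ (τ : Set E)) : E) ∈ τ := interior_subset (s := ((↑) : affineSpan ℝ (τ : Set E) → E) ⁻¹' (τ : Set E)) hs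
  refine hF.mem_of_smul_add_mem (a := s) hy hmem hs0 ?_
  convert PointedCone.smul_mem F (show 0 ≤ 1 + s by linarith) hxF using 1
  simp [g, q, AffineMap.lineMap_apply, smul_sub, add_smul]
  abel

end Normed

end ToricNested

namespace ToricNested

open Set

/-! ### Combinatorics of building sets, nested sets and blowups. -/

section Posets

variable {L : Type*} [PartialOrder L]

/-- In a finite poset with binary meets, a set with an upper bound has a join. -/
theorem exists_isLUB_of_bddAbove [Finite L] (hinf : ∀ a b : L, ∃ m, IsGLB {a, b} m) {A : Set L}
    (hA : BddAbove A) : ∃ j, IsLUB A j := by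
  obtain ⟨u, hu⟩ := hA
  obtain ⟨j, hju, hj⟩ := (toFinite (upperBounds A)).exists_le_minimal hu
  refine ⟨j, hj.1, fun v hv => ?_⟩
  obtain ⟨m, hm⟩ := hinf j v
  have hmA : m ∈ upperBounds A := fun a ha => hm.2 (by
    rintro w (rfl | rfl)
    exacts [hj.1 ha, hv ha])
  exact (hj.2 hmA (hm.1 (mem_insert _ _))).trans (hm.1 (mem_insert_of_mem _ rfl))

theorem factors_subset {𝒢 : Set L} {x : L} : factors 𝒢 x ⊆ 𝒢 := fun _ hy => hy.1.1

theorem le_of_mem_factors {𝒢 : Set L} {x y : L} (hy : y ∈ factors 𝒢 x) : y ≤ x := hy.1.2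

theorem exists_le_factor [Finite L] {𝒢 : Set L} {x g : L} (hg : g ∈ 𝒢) (hgx : g ≤ x) :
    ∃ y ∈ factors 𝒢 x, g ≤ y := by
  obtain ⟨y, hgy, hy⟩ := (toFinite {z | z ∈ 𝒢 ∧ z ≤ x}).exists_le_maximal ⟨hg, hgx⟩
  exact ⟨y, hy, hgy⟩

theorem eq_of_mem_factors {𝒢 : Set L} {x y z : L} (hy : y ∈ factors 𝒢 x) (hz : z ∈ 𝒢)
    (hzx : z ≤ x) (hyz : y ≤ z) : y = z :=
  hyz.antisymm (hy.2 ⟨hz, hzx⟩ hyz)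

theorem factors_antichain {𝒢 : Set L} {x : L} : IsAntichain (· ≤ ·) (factors 𝒢 x) :=
  fun _ hy _ hz hne hle => hne (eq_of_mem_factors hy hz.1.1 hz.1.2 hle)

theorem factors_of_mem {𝒢 : Set L} {g : L} (hg : g ∈ 𝒢) : factors 𝒢 g = {g} := by
  ext y
  refine ⟨fun hy => eq_of_mem_factors hy hg le_rfl hy.1.2, ?_⟩
  rintro rfl
  exact ⟨⟨hg, le_rfl⟩, fun z hz _ => hz.2⟩

/-- A join lying in `𝒢` would be below a single factor, and incomparability of factors would then
collapse `A` to that one factor. -/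
theorem isNested_factors [Finite L] {𝒢 : Set L} (hinf : ∀ a b : L, ∃ m, IsGLB {a, b} m)
    (x : L) : IsNested 𝒢 (factors 𝒢 x) := by
  classical
  refine ⟨factors_subset, fun A hA hnt hanti => ?_⟩
  obtain ⟨j, hj⟩ := exists_isLUB_of_bddAbove hinf (A := A) ⟨x, fun a ha => (hA ha).1.2⟩
  refine ⟨j, hj, fun hj𝒢 => ?_⟩
  have hjx : j ≤ x := hj.2 fun a ha => (hA ha).1.2
  obtain ⟨y, hy, hjy⟩ := exists_le_factor hj𝒢 hjx
  obtain ⟨a, ha, b, hb, hab⟩ := hnt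
  have h1 := factors_antichain.eq (hA ha) hy ((hj.1 ha).trans hjy)
  have h2 := factors_antichain.eq (hA hb) hy ((hj.1 hb).trans hjy)
  exact hab (h1.trans h2.symm)

theorem isNested_singleton {𝒢 : Set L} {g : L} (hg : g ∈ 𝒢) : IsNested 𝒢 {g} :=
  ⟨singleton_subset_iff.2 hg, fun _ hA hnt _ =>
    absurd hnt (not_nontrivial_iff.2 (subsingleton_singleton.anti hA))⟩

/-- The faces of the poset obtained from `L` by blowing up the elements of `P`: pairs of a set
`N ⊆ P` and an element `ρ` that is not above any element of `P`, such that `N` and the factors of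
`ρ` form a nested set. -/
def blowupFaces (𝒢 P : Set L) : Set (Set L × L) :=
  {p | p.1 ⊆ P ∧ (∀ g ∈ P, ¬ g ≤ p.2) ∧ IsNested 𝒢 (p.1 ∪ factors 𝒢 p.2)}

theorem mem_blowupFaces_of_insert {𝒢 P : Set L} {g : L} {p : Set L × L}
    (hp : p ∈ blowupFaces 𝒢 (insert g P)) : (p.1 \ {g}, p.2) ∈ blowupFaces 𝒢 P :=
  ⟨fun _ ha => (hp.1 ha.1).resolve_left ha.2, fun a ha => hp.2.1 a (mem_insert_of_mem _ ha),
    hp.2.2.subset (union_subset_union_left _ sdiff_subset)⟩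

variable [OrderBot L] {𝒢 : Set L}

theorem IsBuildingSet.factors_bot (h𝒢 : IsBuildingSet 𝒢) : factors 𝒢 ⊥ = ∅ := by
  refine eq_empty_of_forall_notMem fun y hy => h𝒢.1 ?_
  rw [← le_bot_iff.1 hy.1.2]
  exact hy.1.1

/-- Every element is the join of its factors. -/
theorem IsBuildingSet.isLUB_factors (hinf : ∀ a b : L, ∃ m, IsGLB {a, b} m)
    (h𝒢 : IsBuildingSet 𝒢) (x : L) : IsLUB (factors 𝒢 x) x := by
  classical
  refine ⟨fun y hy => hy.1.2, fun u hu => ?_⟩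
  by_cases hx : x = ⊥
  · exact hx ▸ bot_le
  obtain ⟨φ, hφ⟩ := h𝒢.2 x hx
  obtain ⟨m, hm⟩ := hinf u x
  have hmx : m ≤ x := hm.1 (mem_insert_of_mem _ rfl)
  -- The meet `m` of `u` and `x` is still above every factor, so all its coordinates are maximal.
  have htop : φ.symm ⟨m, hmx⟩ = ⊤ := by
    ext y
    have hym : (y : L) ≤ m := hm.2 (by
      rintro w (rfl | rfl)
      exacts [hu y.2, le_of_mem_factors y.2])
    have : Function.update ⊥ y ⊤ ≤ φ.symm ⟨m, hmx⟩ := by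
      rw [φ.le_symm_apply, ← Subtype.coe_le_coe, hφ]
      exact hym
    have := this y
    rw [Function.update_self] at this
    rw [top_le_iff.1 this]
    rfl
  have hxm : φ.symm ⟨x, le_rfl⟩ ≤ φ.symm ⟨m, hmx⟩ := htop ▸ le_top
  have hxm : x ≤ m := φ.symm.le_iff_le.1 hxm
  exact hxm.trans (hm.1 (mem_insert _ _))

/-- If `j` is the join of a set `A` of elements of the building set, then every factor of `j` is
the join of the elements of `A` below it. -/
theorem IsBuildingSet.isLUB_inter_factor (h𝒢 : IsBuildingSet 𝒢) [Finite L]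
    (hinf : ∀ a b : L, ∃ m, IsGLB {a, b} m) {A : Set L} (hA : A ⊆ 𝒢) {j : L} (hj : IsLUB A j)
    {y : L} (hy : y ∈ factors 𝒢 j) : IsLUB {a ∈ A | a ≤ y} y := by
  classical
  obtain ⟨u, hu⟩ := exists_isLUB_of_bddAbove hinf (A := {a ∈ A | a ≤ y}) ⟨y, fun a ha => ha.2⟩
  have huy : u ≤ y := hu.2 fun a ha => ha.2
  have huj : u ≤ j := huy.trans hy.1.2
  suffices y ≤ u by rwa [le_antisymm huy this] at hu
  have hj0 : j ≠ ⊥ := by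
    rintro rfl
    rw [h𝒢.factors_bot] at hy
    exact hy
  obtain ⟨φ, hφ⟩ := h𝒢.2 j hj0
  set y' : factors 𝒢 j := ⟨y, hy⟩
  set v := φ.symm ⟨u, huj⟩ with hv
  have hvy : v ≤ Function.update ⊥ y' ⊤ := by
    rw [hv, φ.symm_apply_le, ← Subtype.coe_le_coe, hφ]
    exact huy
  -- Only coordinate `y` is cut down to that of `u`. Elements of `A` below another factor have
  -- coordinate `⊥` there, so `φ w` still bounds `A`; hence `j ≤ φ w` and the cut was trivial.
  set w := Function.update (⊤ : (y : factors 𝒢 j) → Iic (y : L)) y' (v y') with hw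
  have hup : (φ w : L) ∈ upperBounds A := by
    intro a ha
    have haj : a ≤ j := hj.1 ha
    obtain ⟨z, hz, haz⟩ := exists_le_factor (hA ha) haj
    suffices φ.symm ⟨a, haj⟩ ≤ w by
      rw [φ.symm_apply_le] at this
      exact this
    rw [hw, le_update_iff]
    refine ⟨?_, fun _ _ => le_top⟩
    by_cases hzy : z = y
    · have hau : (⟨a, haj⟩ : Iic j) ≤ ⟨u, huj⟩ := hu.1 ⟨ha, hzy ▸ haz⟩
      exact φ.symm.monotone hau y'
    · have : φ.symm ⟨a, haj⟩ ≤ Function.update ⊥ ⟨z, hz⟩ ⊤ := by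
        rw [φ.symm_apply_le, ← Subtype.coe_le_coe, hφ]
        exact haz
      have := this y'
      rw [Function.update_of_ne (fun h => hzy (congrArg Subtype.val h).symm)] at this
      exact this.trans bot_le
  have hjw : (⊤ : (y : factors 𝒢 j) → Iic (y : L)) ≤ w := by
    rw [← φ.le_iff_le, φ.map_top]
    exact (hj.2 hup : j ≤ (φ w : L))
  have hvtop : v y' = ⊤ := by
    have := hjw y'
    rw [hw, Function.update_self] at this
    exact top_le_iff.1 this
  have hle : Function.update ⊥ y' ⊤ ≤ v := by
    rw [update_le_iff]
    exact ⟨hvtop.ge, fun _ _ => bot_le⟩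
  rw [hv, φ.le_symm_apply, ← Subtype.coe_le_coe, hφ] at hle
  exact hle

/-- An element of the building set that lies below the join of a nested set lies below one of the
elements of the nested set. -/
theorem IsNested.exists_le_of_le_isLUB [Finite L] (hinf : ∀ a b : L, ∃ m, IsGLB {a, b} m)
    (h𝒢 : IsBuildingSet 𝒢) {A : Set L} (hA : IsNested 𝒢 A) {j g : L} (hj : IsLUB A j)
    (hg : g ∈ 𝒢) (hgj : g ≤ j) : ∃ a ∈ A, g ≤ a := by
  obtain ⟨y, hy, hgy⟩ := exists_le_factor hg hgj
  have hlub := h𝒢.isLUB_inter_factor hinf hA.1 hj hy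
  suffices hyA : y ∈ A from ⟨y, hyA, hgy⟩
  -- The maximal elements form an antichain with the same join `y ∈ 𝒢`; nestedness forbids two of
  -- them.
  set B := {a | Maximal (· ∈ {a ∈ A | a ≤ y}) a} with hB
  have hBlub : IsLUB B y := by
    refine ⟨fun a ha => ha.1.2, fun v hv => hlub.2 fun a ha => ?_⟩
    obtain ⟨b, hab, hb⟩ := (toFinite {a ∈ A | a ≤ y}).exists_le_maximal ha
    exact hab.trans (hv hb)
  have hBA : B ⊆ A := fun b hb => hb.1.1
  rcases B.subsingleton_or_nontrivial with hs | hnt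
  · rcases hs.eq_empty_or_singleton with h | ⟨b, hb⟩
    · rw [h, isLUB_empty_iff] at hBlub
      exact absurd (hBlub.eq_bot ▸ hy.1.1) h𝒢.1
    · rw [hb] at hBlub
      rw [hBlub.unique isLUB_singleton]
      exact hBA (hb ▸ rfl)
  · obtain ⟨k, hk, hk𝒢⟩ := hA.2 B hBA hnt fun a ha b hb hne hle => hne (ha.eq_of_le hb.1 hle)
    exact absurd (hk.unique hBlub ▸ hy.1.1) hk𝒢

/-- A nested set in a finite poset has a join. -/
theorem IsNested.exists_isLUB [Finite L] {A : Set L} (hA : IsNested 𝒢 A) : ∃ j, IsLUB A j := by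
  set B := {a | Maximal (· ∈ A) a} with hB
  suffices ∃ j, IsLUB B j by
    obtain ⟨j, hj⟩ := this
    refine ⟨j, fun a ha => ?_, fun v hv => hj.2 fun b hb => hv hb.1⟩
    obtain ⟨b, hab, hb⟩ := (toFinite A).exists_le_maximal ha
    exact hab.trans (hj.1 hb)
  rcases B.subsingleton_or_nontrivial with hs | hnt
  · rcases hs.eq_empty_or_singleton with h | ⟨b, hb⟩
    · exact ⟨⊥, h ▸ isLUB_empty⟩
    · exact ⟨b, hb ▸ isLUB_singleton⟩
  · obtain ⟨k, hk, -⟩ := hA.2 B (fun b hb => hb.1) hnt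
      fun a ha b hb hne hle => hne (ha.eq_of_le hb.1 hle)
    exact ⟨k, hk⟩

/-- A face in the link of a blown up element `g`, together with `g`, is a face of the blowup. -/
theorem insert_mem_blowupFaces [Finite L] (hinf : ∀ a b : L, ∃ m, IsGLB {a, b} m)
    (h𝒢 : IsBuildingSet 𝒢) {P : Set L} {g : L} (hg : g ∈ 𝒢)
    (hP : ∀ h ∈ 𝒢, g < h → h ∈ P) {N N' : Set L} {ρ ρ' : L}
    (hp : (N, ρ) ∈ blowupFaces 𝒢 P) (hp' : (N', ρ') ∈ blowupFaces 𝒢 P) (hN : N ⊆ N')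
    (hρ : ρ ≤ ρ') (hgρ : ¬ g ≤ ρ) (hgρ' : g ≤ ρ') :
    (insert g N, ρ) ∈ blowupFaces 𝒢 (insert g P) := by
  have hgfac : g ∈ factors 𝒢 ρ' := by
    refine ⟨⟨hg, hgρ'⟩, fun h hh hgh => ?_⟩
    by_contra hne
    exact hp'.2.1 h (hP h hh.1 (lt_of_le_not_ge hgh hne)) hh.2
  have hsub : insert g N ∪ factors 𝒢 ρ ⊆ 𝒢 :=
    union_subset (insert_subset hg (subset_union_left.trans hp.2.2.1)) factors_subset
  refine ⟨insert_subset_insert hp.1, ?_, hsub, fun B hB hnt hanti => ?_⟩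
  · rintro h (rfl | hh)
    exacts [hgρ, hp.2.1 h hh]
  by_cases hgB : g ∈ B
  swap
  · refine hp.2.2.2 B (fun b hb => ?_) hnt hanti
    rcases hB hb with (rfl | h) | h
    exacts [absurd hb hgB, Or.inl h, Or.inr h]
  -- This set is nested as part of the larger face, and its join bounds `B`. If the join `k` of `B`
  -- were in `𝒢`, it would lie below one of its members: one in `B` contradicts incomparability, and
  -- a factor of `ρ'` must be `g`, forcing `k = g`.
  have hnest : IsNested 𝒢 (B ∩ N ∪ factors 𝒢 ρ') :=
    hp'.2.2.subset (union_subset_union_left _ (inter_subset_right.trans hN))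
  obtain ⟨j, hj⟩ := hnest.exists_isLUB
  have hρj : ρ ≤ j := hρ.trans ((h𝒢.isLUB_factors hinf ρ').2 fun a ha => hj.1 (Or.inr ha))
  have hBj : j ∈ upperBounds B := by
    intro b hb
    rcases hB hb with (rfl | h) | h
    exacts [hj.1 (Or.inr hgfac), hj.1 (Or.inl ⟨hb, h⟩), (le_of_mem_factors h).trans hρj]
  obtain ⟨k, hk⟩ := exists_isLUB_of_bddAbove hinf ⟨j, hBj⟩
  refine ⟨k, hk, fun hk𝒢 => ?_⟩
  have hgk := hk.1 hgB
  have hkg : k = g → False := by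
    rintro rfl
    obtain ⟨b, hb, hne⟩ := hnt.exists_ne k
    exact hne (hanti.eq hb hgB (hk.1 hb))
  obtain ⟨a, ha, hka⟩ := hnest.exists_le_of_le_isLUB hinf h𝒢 hj hk𝒢 (hk.2 hBj)
  rcases ha with ha | ha
  · obtain ⟨b, hb, hne⟩ := hnt.exists_ne a
    exact hne (hanti.eq hb ha.1 ((hk.1 hb).trans hka))
  · obtain rfl := factors_antichain.eq hgfac ha (hgk.trans hka)
    exact hkg (le_antisymm hka hgk)

/-- Every face of the blowup that contains the blown up element `g` lies in the link of `g`. -/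
theorem exists_mem_blowupFaces_of_insert [Finite L] (hinf : ∀ a b : L, ∃ m, IsGLB {a, b} m)
    (h𝒢 : IsBuildingSet 𝒢) {P : Set L} (hP𝒢 : P ⊆ 𝒢) {g : L}
    (hP : ∀ h ∈ P, ¬ h ≤ g) {N : Set L} {ρ : L}
    (hp : (N, ρ) ∈ blowupFaces 𝒢 (insert g P)) (hgN : g ∈ N) :
    ∃ ρ', (N \ {g}, ρ') ∈ blowupFaces 𝒢 P ∧ ρ ≤ ρ' ∧ g ≤ ρ' := by
  have hsub : insert g (factors 𝒢 ρ) ⊆ N ∪ factors 𝒢 ρ :=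
    insert_subset (Or.inl hgN) subset_union_right
  have hnest := hp.2.2.subset hsub
  -- The witness is the join of `g` and `ρ`; its factors are among `g` and the factors of `ρ`, so
  -- nestedness is inherited.
  obtain ⟨ρ', hρ'⟩ := hnest.exists_isLUB
  have hfac : factors 𝒢 ρ' ⊆ insert g (factors 𝒢 ρ) := by
    intro y hy
    obtain ⟨a, ha, hya⟩ := hnest.exists_le_of_le_isLUB hinf h𝒢 hρ' hy.1.1 hy.1.2
    rwa [eq_of_mem_factors hy (hnest.1 ha) (hρ'.1 ha) hya]
  refine ⟨ρ', ⟨fun a ha => (hp.1 ha.1).resolve_left ha.2, fun h hh hle => ?_,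
    hp.2.2.subset (union_subset (sdiff_subset.trans subset_union_left) (hfac.trans hsub))⟩,
    (h𝒢.isLUB_factors hinf ρ).2 fun a ha => hρ'.1 (Or.inr ha), hρ'.1 (mem_insert _ _)⟩
  obtain ⟨a, rfl | ha, hha⟩ := hnest.exists_le_of_le_isLUB hinf h𝒢 hρ' (hP𝒢 hh) hle
  · exact hP h hh hha
  · exact hp.2.1 h (mem_insert_of_mem _ hh) (hha.trans (le_of_mem_factors ha))

end Posets

end ToricNested

namespace ToricNested

open Set

/-! ### Realizing blowups of the face poset by fans. -/

section BlowupFan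

variable {E : Type*}

section Module

variable [AddCommGroup E] [Module ℝ E]

theorem IsFan.finite_facePoset {S : Set (PointedCone ℝ E)} (hS : IsFan S) :
    Finite (FacePoset S) :=
  (hS.finite.insert ⊥).to_subtype

theorem IsFan.exists_isGLB_facePoset {S : Set (PointedCone ℝ E)} (hS : IsFan S)
    (a b : FacePoset S) : ∃ m, IsGLB {a, b} m := by
  have hmem : (a : PointedCone ℝ E) ⊓ b ∈ insert ⊥ S := by
    rcases a.2 with ha | ha
    · rw [ha, bot_inf_eq]
      exact mem_insert _ _
    rcases b.2 with hb | hb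
    · rw [hb, inf_bot_eq]
      exact mem_insert _ _
    exact Or.inr (hS.inf_mem ha hb)
  refine ⟨⟨_, hmem⟩, ?_, fun m hm => ?_⟩
  · rintro c (rfl | rfl)
    exacts [(inf_le_left : (c : PointedCone ℝ E) ⊓ b ≤ c),
      (inf_le_right : (a : PointedCone ℝ E) ⊓ c ≤ c)]
  · exact (le_inf (hm (mem_insert _ _)) (hm (mem_insert_of_mem _ rfl)) :
      (m : PointedCone ℝ E) ≤ (a : PointedCone ℝ E) ⊓ b)

/-- The cone spanned by the points `V g` for `g ∈ p.1` and by the cone `p.2`. -/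
def blowupCone {S : Set (PointedCone ℝ E)} (V : FacePoset S → E)
    (p : Set (FacePoset S) × FacePoset S) : PointedCone ℝ E :=
  PointedCone.hull ℝ (V '' p.1) ⊔ p.2

variable {S : Set (PointedCone ℝ E)} {V : FacePoset S → E}

theorem blowupCone_empty (ρ : FacePoset S) : blowupCone V (∅, ρ) = ρ := by
  simp [blowupCone]

theorem blowupCone_bot (N : Set (FacePoset S)) :
    blowupCone V (N, ⊥) = PointedCone.hull ℝ (V '' N) :=
  sup_bot_eq _

theorem blowupCone_insert (g : FacePoset S) (N : Set (FacePoset S)) (ρ : FacePoset S) :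
    blowupCone V (insert g N, ρ) = PointedCone.hull ℝ {V g} ⊔ blowupCone V (N, ρ) := by
  simp only [blowupCone, image_insert_eq, PointedCone.hull, ← sup_assoc, ← Submodule.span_union,
    singleton_union]

theorem blowupCone_mono : Monotone (blowupCone V) := fun _ _ h =>
  sup_le_sup (Submodule.span_mono (image_mono h.1)) h.2

theorem span_sup_span_le_span_blowupCone (N : Set (FacePoset S)) (ρ : FacePoset S) :
    Submodule.span ℝ (V '' N) ⊔ Submodule.span ℝ ((ρ : PointedCone ℝ E) : Set E) ≤
      Submodule.span ℝ (blowupCone V (N, ρ) : Set E) :=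
  sup_le (Submodule.span_mono (Submodule.subset_span.trans
      (show (PointedCone.hull ℝ (V '' N) : Set E) ⊆ _ from
        (le_sup_left : PointedCone.hull ℝ (V '' N) ≤ blowupCone V (N, ρ)))))
    (Submodule.span_mono
      (le_sup_right : (ρ : PointedCone ℝ E) ≤ blowupCone V (N, ρ)))

/-- `T` is a subdivision of `S` that realizes the blowup of the face poset of `S` in the elements
of `P`, at the points `V g`. -/
structure IsBlowup (S : Set (PointedCone ℝ E)) (V : FacePoset S → E) (𝒢 P : Set (FacePoset S))
    (T : Set (PointedCone ℝ E)) : Prop where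
  isSubdivision : IsSubdivision T S
  insert_bot_eq : insert ⊥ T = blowupCone V '' blowupFaces 𝒢 P
  le_of_le : ∀ p ∈ blowupFaces 𝒢 P, ∀ q ∈ blowupFaces 𝒢 P,
    blowupCone V p ≤ blowupCone V q → p ≤ q
  linearIndepOn : ∀ p ∈ blowupFaces 𝒢 P, LinearIndepOn ℝ V p.1
  disjoint_span : ∀ p ∈ blowupFaces 𝒢 P, Disjoint (Submodule.span ℝ (V '' p.1))
    (Submodule.span ℝ ((p.2 : PointedCone ℝ E) : Set E))

theorem IsSubdivision.trans {S₁ S₂ S₃ : Set (PointedCone ℝ E)} (h₁ : IsSubdivision S₁ S₂)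
    (h₂ : IsSubdivision S₂ S₃) : IsSubdivision S₁ S₃ := by
  refine ⟨h₁.isFan, fun C hC => ?_, h₁.support_eq.trans h₂.support_eq⟩
  obtain ⟨D, hD, hCD⟩ := h₁.refines C hC
  obtain ⟨F, hF, hDF⟩ := h₂.refines D hD
  exact ⟨F, hF, hCD.trans hDF⟩

theorem isBlowup_empty (hS : IsFan S) (V : FacePoset S → E) (𝒢 : Set (FacePoset S)) :
    IsBlowup S V 𝒢 ∅ S := by
  have hfin := hS.finite_facePoset
  have key : ∀ p ∈ blowupFaces 𝒢 ∅, p.1 = ∅ := fun p hp => subset_empty_iff.1 hp.1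
  refine ⟨⟨hS, fun C hC => ⟨C, hC, le_rfl⟩, rfl⟩, ?_, ?_, ?_, ?_⟩
  · ext C
    constructor
    · intro hC
      refine ⟨(∅, ⟨C, hC⟩), ⟨Subset.rfl, by simp, ?_⟩, blowupCone_empty _⟩
      simpa using isNested_factors hS.exists_isGLB_facePoset _
    · rintro ⟨⟨N, ρ⟩, hp, rfl⟩
      obtain rfl : N = ∅ := key _ hp
      rw [blowupCone_empty]
      exact ρ.2
  · rintro ⟨N, ρ⟩ hp ⟨M, μ⟩ hq hle
    obtain rfl : N = ∅ := key _ hp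
    obtain rfl : M = ∅ := key _ hq
    rw [blowupCone_empty, blowupCone_empty] at hle
    exact ⟨le_rfl, hle⟩
  · intro p hp
    rw [key p hp]
    exact linearIndepOn_empty ℝ V
  · intro p hp
    rw [key p hp]
    simp

end Module

variable [NormedAddCommGroup E] [NormedSpace ℝ E]
variable {S : Set (PointedCone ℝ E)} {V : FacePoset S → E} {𝒢 P : Set (FacePoset S)}
  {T : Set (PointedCone ℝ E)}

/-- No subdivided element lies below `g`, so `g` survives as the pair `(∅, g)`; being nonzero, it is
not merely the adjoined bottom. -/
theorem IsBlowup.mem (hT : IsBlowup S V 𝒢 P T) (h𝒢 : IsBuildingSet 𝒢) {g : FacePoset S}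
    (hg : g ∈ 𝒢) (hP : ∀ h ∈ P, ¬ h ≤ g) :
    (∅, g) ∈ blowupFaces 𝒢 P ∧ (g : PointedCone ℝ E) ∈ T := by
  have hface : (∅, g) ∈ blowupFaces 𝒢 P := by
    refine ⟨empty_subset _, hP, ?_⟩
    rw [factors_of_mem hg, empty_union]
    exact isNested_singleton hg
  have hmem : (g : PointedCone ℝ E) ∈ insert ⊥ T := by
    rw [hT.insert_bot_eq]
    exact ⟨_, hface, blowupCone_empty g⟩
  refine ⟨hface, hmem.resolve_left fun h => h𝒢.1 ?_⟩
  rwa [show (⊥ : FacePoset S) = g from Subtype.ext h.symm]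

/-- Blowing up a further element of the building set is realized by a stellar subdivision. -/
theorem IsBlowup.stellarSubdivision (hS : IsFan S) (hT : IsBlowup S V 𝒢 P T)
    (h𝒢 : IsBuildingSet 𝒢) (hP𝒢 : P ⊆ 𝒢) {g : FacePoset S} (hg : g ∈ 𝒢)
    (hgP : ∀ h ∈ P, ¬ h ≤ g) (hPg : ∀ h ∈ 𝒢, g < h → h ∈ P)
    (hV : V g ∈ intrinsicInterior ℝ ((g : PointedCone ℝ E) : Set E)) :
    IsBlowup S V 𝒢 (insert g P) (ToricNested.stellarSubdivision T g (V g)) := by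
  have hfin := hS.finite_facePoset
  have hinf := hS.exists_isGLB_facePoset
  have hfan := hT.isSubdivision.isFan
  obtain ⟨hface, hgT⟩ := hT.mem h𝒢 hg hgP
  have hbot : ⊥ ∈ T := hfan.bot_mem hgT
  have hTeq : T = blowupCone V '' blowupFaces 𝒢 P := by
    rw [← hT.insert_bot_eq, insert_eq_of_mem hbot]
  have hgbot : ¬ (g : PointedCone ℝ E) ≤ ⊥ := fun h => h𝒢.1 (by
    rwa [show (⊥ : FacePoset S) = g from Subtype.ext (le_bot_iff.1 h).symm])
  have hVg : V g ∈ (g : PointedCone ℝ E) := intrinsicInterior_subset hV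
  have hVT : ∀ ρ ∈ T, V g ∈ ρ → (g : PointedCone ℝ E) ≤ ρ := fun ρ hρ hx =>
    (le_of_mem_intrinsicInterior (hfan.inter_face _ hgT ρ hρ).1 hV ⟨hVg, hx⟩).trans inf_le_right
  have hV0 : V g ≠ 0 := fun h => hgbot (hVT ⊥ hbot (by simp [h]))
  have hmemT : ∀ p ∈ blowupFaces 𝒢 P, blowupCone V p ∈ T := fun p hp =>
    hTeq ▸ mem_image_of_mem _ hp
  have hstar : ∀ p ∈ blowupFaces 𝒢 P, ((g : PointedCone ℝ E) ≤ blowupCone V p ↔ g ≤ p.2) := by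
    intro p hp
    constructor
    · intro h
      rw [← blowupCone_empty (V := V) g] at h
      exact (hT.le_of_le _ hface _ hp h).2
    · exact fun h => le_trans h le_sup_right
  -- faces of the blowup that do not contain `g`
  have hold : ∀ N ρ, (N, ρ) ∈ blowupFaces 𝒢 (insert g P) →
      (N \ {g}, ρ) ∈ blowupFaces 𝒢 P ∧
        blowupCone V (N \ {g}, ρ) ∈ T \ coneStar g T := by
    intro N ρ hp
    have h := mem_blowupFaces_of_insert hp
    exact ⟨h, hmemT _ h, fun h' => hp.2.1 g (mem_insert _ _) ((hstar _ h).1 h'.2)⟩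
  -- faces of the blowup that contain `g`
  have hnew : ∀ N ρ, (N, ρ) ∈ blowupFaces 𝒢 (insert g P) → g ∈ N →
      blowupCone V (N, ρ) = PointedCone.hull ℝ {V g} ⊔ blowupCone V (N \ {g}, ρ) ∧
        ∃ σ ∈ coneStar g T, blowupCone V (N \ {g}, ρ) ≤ σ := by
    intro N ρ hp hgN
    obtain ⟨ρ', hp', hρ, hgρ⟩ := exists_mem_blowupFaces_of_insert hinf h𝒢 hP𝒢 hgP hp hgN
    refine ⟨?_, _, ⟨hmemT _ hp', (hstar _ hp').2 hgρ⟩, blowupCone_mono ⟨le_rfl, hρ⟩⟩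
    rw [← blowupCone_insert, insert_sdiff_singleton, insert_eq_of_mem hgN]
  have heq : ToricNested.stellarSubdivision T g (V g) = blowupCone V '' blowupFaces 𝒢 (insert g P) := by
    apply Subset.antisymm
    · rintro C (hC | ⟨ρ, hρ, ⟨σ, hσ, hρσ⟩, rfl⟩)
      · obtain ⟨p, hp, rfl⟩ := hTeq ▸ hC.1
        refine ⟨p, ⟨hp.1.trans (subset_insert _ _), ?_, hp.2.2⟩, rfl⟩
        rintro h (rfl | hh)
        exacts [fun hle => hC.2 ⟨hC.1, (hstar p hp).2 hle⟩, hp.2.1 h hh]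
      · obtain ⟨⟨N, ρ⟩, hp, rfl⟩ := hTeq ▸ hρ.1
        obtain ⟨⟨N', ρ'⟩, hp', rfl⟩ := hTeq ▸ hσ.1
        have hle := hT.le_of_le _ hp _ hp' hρσ
        exact ⟨_, insert_mem_blowupFaces hinf h𝒢 hg hPg hp hp' hle.1 hle.2
          (fun h => hρ.2 ⟨hρ.1, (hstar _ hp).2 h⟩) ((hstar _ hp').1 hσ.2), blowupCone_insert _ _ _⟩
    · rintro _ ⟨⟨N, ρ⟩, hp, rfl⟩
      by_cases hgN : g ∈ N
      · obtain ⟨h1, h2⟩ := hnew N ρ hp hgN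
        exact Or.inr ⟨_, (hold N ρ hp).2, h2, h1⟩
      · have := (hold N ρ hp).2
        rw [sdiff_singleton_eq_self hgN] at this
        exact Or.inl this
  refine ⟨(hfan.isSubdivision_stellarSubdivision hVg hV0 hVT).trans hT.isSubdivision, ?_, ?_,
    ?_, ?_⟩
  · rw [← heq]
    exact insert_eq_of_mem (Or.inl ⟨hbot, fun h => hgbot h.2⟩)
  · rintro ⟨N, ρ⟩ hp ⟨M, μ⟩ hq hle
    obtain ⟨hp', hpT⟩ := hold N ρ hp
    obtain ⟨hq', hqT⟩ := hold M μ hq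
    have hsub : blowupCone V (N \ {g}, ρ) ≤ blowupCone V (N, ρ) :=
      blowupCone_mono ⟨sdiff_subset, le_rfl⟩
    -- Without `g` in `M`, the larger cone is an old one outside the star, so it cannot contain `V
    -- g`.
    have hgM : g ∈ N → g ∈ M := by
      intro hgN
      by_contra hgM
      rw [sdiff_singleton_eq_self hgM] at hqT
      refine hqT.2 ⟨hqT.1, hVT _ hqT.1 (hle ?_)⟩
      rw [(hnew N ρ hp hgN).1]
      exact self_mem_hull_singleton_sup _ _
    -- An old cone outside the star meets a cone over the link only in its base, so the inclusion
    -- descends to the previous fan.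
    have hle' : blowupCone V (N \ {g}, ρ) ≤ blowupCone V (M \ {g}, μ) := by
      by_cases hgM : g ∈ M
      · obtain ⟨h1, σ, hσ, hμσ⟩ := hnew M μ hq hgM
        have := hfan.hull_sup_inf hVg hVT hσ.1 hσ.2 hμσ hpT.1 fun h => hpT.2 ⟨hpT.1, h⟩
        rw [← h1, inf_eq_right.2 (hsub.trans hle)] at this
        exact inf_eq_right.1 this.symm
      · rw [sdiff_singleton_eq_self hgM]
        exact hsub.trans hle
    have h := hT.le_of_le _ hp' _ hq' hle'
    refine ⟨fun a ha => ?_, h.2⟩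
    by_cases hag : a = g
    · exact hag ▸ hgM (hag ▸ ha)
    · exact (h.1 ⟨ha, hag⟩).1
  all_goals
    rintro ⟨N, ρ⟩ hp
    obtain ⟨hp', hpT⟩ := hold N ρ hp
    by_cases hgN : g ∈ N
    swap
    · rw [sdiff_singleton_eq_self hgN] at hp'
      first
      | exact hT.linearIndepOn _ hp'
      | exact hT.disjoint_span _ hp'
    obtain ⟨h1, σ, hσ, hρσ⟩ := hnew N ρ hp hgN
    -- The base is a proper face of a star cone and misses `V g`; both the independence and the
    -- disjointness goals follow from this.
    have hspan : V g ∉ Submodule.span ℝ (V '' (N \ {g})) ⊔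
        Submodule.span ℝ ((ρ : PointedCone ℝ E) : Set E) := fun h =>
      notMem_span_of_face (hfan.isFaceOf hpT.1 hσ.1 hρσ) (hσ.2 hVg)
        (fun h => hpT.2 ⟨hpT.1, hVT _ hpT.1 h⟩) (span_sup_span_le_span_blowupCone _ _ h)
    have hN : N = insert g (N \ {g}) := by
      rw [insert_sdiff_singleton, insert_eq_of_mem hgN]
  · show LinearIndepOn ℝ V N
    rw [hN]
    exact (hT.linearIndepOn _ hp').insert fun h => hspan (Submodule.mem_sup_left h)
  · have hdisj := hT.disjoint_span _ hp'
    show Disjoint (Submodule.span ℝ (V '' N)) (Submodule.span ℝ ((ρ : PointedCone ℝ E) : Set E))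
    rw [hN, image_insert_eq, Submodule.span_insert]
    refine Disjoint.disjoint_sup_left_of_disjoint_sup_right hdisj ?_
    rw [disjoint_comm, Submodule.disjoint_span_singleton' hV0]
    exact hspan

/-- The faces of the blowup in all elements of the building set are the faces of the
nested set complex. -/
theorem mem_blowupFaces_self (hS : IsFan S) (h𝒢 : IsBuildingSet 𝒢)
    {p : Set (FacePoset S) × FacePoset S} :
    p ∈ blowupFaces 𝒢 𝒢 ↔ p.2 = ⊥ ∧ IsNested 𝒢 p.1 := by
  obtain ⟨N, ρ⟩ := p
  constructor
  · rintro ⟨-, hρ, hN⟩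
    have hfac : factors 𝒢 ρ = ∅ :=
      eq_empty_of_forall_notMem fun y hy => hρ y hy.1.1 hy.1.2
    have hlub := h𝒢.isLUB_factors hS.exists_isGLB_facePoset ρ
    rw [hfac, isLUB_empty_iff] at hlub
    exact ⟨hlub.eq_bot, hN.subset subset_union_left⟩
  · rintro ⟨rfl : ρ = ⊥, hN⟩
    refine ⟨hN.1, fun g hg hle => h𝒢.1 (le_bot_iff.1 hle ▸ hg), ?_⟩
    rw [h𝒢.factors_bot, union_empty]
    exact hN

theorem IsBlowup.isSimplicial (hS : IsFan S) (h𝒢 : IsBuildingSet 𝒢) (hT : IsBlowup S V 𝒢 𝒢 T)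
    {C : PointedCone ℝ E} (hC : C ∈ T) : C.IsSimplicial := by
  have hfin := hS.finite_facePoset
  obtain ⟨⟨N, ρ⟩, hp, rfl⟩ := hT.insert_bot_eq ▸ mem_insert_of_mem ⊥ hC
  obtain ⟨rfl : ρ = ⊥, -⟩ := (mem_blowupFaces_self hS h𝒢).1 hp
  rw [blowupCone_bot]
  exact .hull (toFinite _) (hT.linearIndepOn _ hp).id_image

/-- With `ρ = 0` throughout, order reflection makes the map to cones an embedding, and the indexing
of the fan makes it onto. -/
theorem IsBlowup.exists_orderIso (hS : IsFan S) (h𝒢 : IsBuildingSet 𝒢)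
    (hT : IsBlowup S V 𝒢 𝒢 T) : ∃ e : NestedSetFaces 𝒢 ≃o FacePoset T,
      ∀ N, (e N : PointedCone ℝ E) = PointedCone.hull ℝ (V '' N.1) := by
  have hmem : ∀ N : NestedSetFaces 𝒢, (N.1, ⊥) ∈ blowupFaces 𝒢 𝒢 := fun N =>
    (mem_blowupFaces_self hS h𝒢).2 ⟨rfl, N.2⟩
  let f : NestedSetFaces 𝒢 → FacePoset T := fun N =>
    ⟨blowupCone V (N.1, ⊥), hT.insert_bot_eq ▸ mem_image_of_mem _ (hmem N)⟩
  have hf : ∀ N M, f N ≤ f M ↔ N ≤ M := fun N M =>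
    ⟨fun h => (hT.le_of_le _ (hmem N) _ (hmem M) h).1, fun h => blowupCone_mono ⟨h, le_rfl⟩⟩
  have hsurj : Function.Surjective f := by
    rintro ⟨C, hC⟩
    obtain ⟨⟨N, ρ⟩, hp, rfl⟩ := hT.insert_bot_eq ▸ hC
    obtain ⟨rfl : ρ = ⊥, hN⟩ := (mem_blowupFaces_self hS h𝒢).1 hp
    exact ⟨⟨N, hN⟩, rfl⟩
  exact ⟨RelIso.ofSurjective (OrderEmbedding.ofMapLEIff f hf) hsurj, fun N => blowupCone_bot _⟩

end BlowupFan

end ToricNested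

/-! ### Induction along the enumeration. -/

theorem theorem4p10 (d : ℕ)
    (S : Set (PointedCone ℝ (EuclideanSpace ℝ (Fin d)))) (hS : ToricNested.IsFan S)
    (𝒢 : Set (ToricNested.FacePoset S)) (h𝒢 : ToricNested.IsBuildingSet 𝒢)
    -- an enumeration of the building set in non-increasing order
    (t : ℕ) (G : Fin t → ToricNested.FacePoset S)
    (hG_inj : Function.Injective G) (hG_range : Set.range G = 𝒢)
    (hG_order : ∀ i j, G j < G i → i < j)
    -- arbitrary points in the relative interiors of the cones of the building set
    (x : Fin t → EuclideanSpace ℝ (Fin d))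
    (hx : ∀ i, x i ∈ intrinsicInterior ℝ ((G i : PointedCone ℝ (EuclideanSpace ℝ (Fin d))) :
      Set (EuclideanSpace ℝ (Fin d))))
    -- the consecutive stellar subdivisions
    (T : Fin (t + 1) → Set (PointedCone ℝ (EuclideanSpace ℝ (Fin d))))
    (hT_zero : T 0 = S)
    (hT_succ : ∀ i : Fin t,
      T i.succ = ToricNested.stellarSubdivision (T i.castSucc) (G i) (x i)) :
    -- every step is a stellar subdivision of a fan in one of its cones
    (∀ i : Fin t, ToricNested.IsFan (T i.castSucc) ∧
      (G i : PointedCone ℝ (EuclideanSpace ℝ (Fin d))) ∈ T i.castSucc) ∧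
    -- the result is a simplicial subdivision of the fan
    ToricNested.IsSubdivision (T (Fin.last t)) S ∧
    (∀ C ∈ T (Fin.last t), C.IsSimplicial) ∧
    -- its face poset is that of the nested set complex, the face `N` of the complex being
    -- the cone spanned by the subdivision points of the elements of `N`
    ∃ e : ToricNested.NestedSetFaces 𝒢 ≃o ToricNested.FacePoset (T (Fin.last t)),
      ∀ N : ToricNested.NestedSetFaces 𝒢,
        (e N : PointedCone ℝ (EuclideanSpace ℝ (Fin d))) =
          PointedCone.hull ℝ {v | ∃ i : Fin t, G i ∈ N.1 ∧ x i = v} := by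
  -- The value `0` off the range of `G` plays no role: first components of blowup faces contain only
  -- elements of `𝒢`.
  set V : ToricNested.FacePoset S → EuclideanSpace ℝ (Fin d) := Function.extend G x 0 with hV
  have hVG : ∀ i, V (G i) = x i := fun i => hG_inj.extend_apply x 0 i
  have hG𝒢 : ∀ i, G i ∈ 𝒢 := fun i => hG_range ▸ Set.mem_range_self i
  have hlt : ∀ i, ∀ h ∈ G '' {j | j < i}, ¬ h ≤ G i := by
    rintro i _ ⟨j, hj, rfl⟩ hle
    have hji : j < i := hj
    exact hji.asymm (hG_order i j (lt_of_le_of_ne hle (hG_inj.ne hji.ne)))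
  have hblow : ∀ i : Fin (t + 1),
      ToricNested.IsBlowup S V 𝒢 (G '' {j | j.castSucc < i}) (T i) := by
    intro i
    induction i using Fin.induction with
    | zero =>
      rw [hT_zero]
      simpa using ToricNested.isBlowup_empty hS V 𝒢
    | succ i ih =>
      simp only [Fin.castSucc_lt_castSucc_iff] at ih
      have hset : G '' {j | j.castSucc < i.succ} = insert (G i) (G '' {j | j < i}) := by
        rw [← Set.image_insert_eq]
        congr 1
        ext j
        simp [Fin.castSucc_lt_succ_iff, le_iff_eq_or_lt]
      rw [hset, hT_succ i, ← hVG i]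
      refine ih.stellarSubdivision hS h𝒢 ?_ (hG𝒢 i) (hlt i) ?_ (by rw [hVG]; exact hx i)
      · rintro _ ⟨j, -, rfl⟩
        exact hG𝒢 j
      · intro h hh hlt
        obtain ⟨j, rfl⟩ := hG_range ▸ hh
        exact ⟨j, hG_order j i hlt, rfl⟩
  have hlast : ToricNested.IsBlowup S V 𝒢 𝒢 (T (Fin.last t)) := by
    have := hblow (Fin.last t)
    simpa [Fin.castSucc_lt_last, hG_range] using this
  refine ⟨fun i => ⟨(hblow i.castSucc).isSubdivision.isFan, ?_⟩, hlast.isSubdivision,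
    fun C hC => hlast.isSimplicial hS h𝒢 hC, ?_⟩
  · have := hblow i.castSucc
    simp only [Fin.castSucc_lt_castSucc_iff] at this
    exact (this.mem h𝒢 (hG𝒢 i) (hlt i)).2
  · obtain ⟨e, he⟩ := hlast.exists_orderIso hS h𝒢
    refine ⟨e, fun N => (he N).trans (congrArg _ ?_)⟩
    ext v
    constructor
    · rintro ⟨g, hg, rfl⟩
      obtain ⟨i, rfl⟩ := hG_range ▸ N.2.1 hg
      exact ⟨i, hg, (hVG i).symm⟩
    · rintro ⟨i, hi, rfl⟩
      exact ⟨G i, hi, hVG i⟩
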